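/- Let $\rho$ be a two-qubit state (a density operator on $\mathbb C^2\otimes\mathbb C^2$, Alice's qubit first) that is canonical, i.e. Alice's marginal is $\mathrm{tr}_B\rho=\frac12\mathbb 1$. Write $\boldsymbol b\in\mathbb R^3$ for the Bloch vector of Bob's marginal $\rho_B=\mathrm{tr}_A\rho$, and $b=|\boldsymbol b|$. For an operator $0\le M\le\mathbb 1$ on Alice's qubit with $p_M:=\mathrm{tr}((M\otimes\mathbb 1)\rho)\neq0$, let $\rho_B^M=\mathrm{tr}_A((M\otimes\mathbb 1)\rho)/p_M$ be Bob's steered state. The maximal steered coherence of $\rho$ is $$\mathcal C(\rho)=\inf_{\Xi}\max_{M}\sum_{i\ne j}|\langle\xi_i|\rho_B^M|\xi_j\rangle| ,$$ where $\Xi=\{|\xi_1\rangle,|\xi_2\rangle\}$ runs over the orthonormal eigenbases of $\rho_B$ (if $\boldsymbol b\ne\boldsymbol 0$, then $\Xi$ is unique up to order and phases and the infimum is redundant). The steering ellipsoid $\mathcal E_B\subset\mathbb R^3$ is the set of the Bloch vectors of all the states $\rho_B^M$. Then the maxima exist, $\mathcal E_B$ is a (solid, possibly degenerate) ellipsoid,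 and if $c_1\ge c_2\ge c_3\ge0$ are the lengths of its semiaxes, then $$\mathcal C(\rho)\le c_1\le\sqrt{1-b^2}.$$ Say that $\mathcal E_B$ is the perpendicular chord with ends $|\chi\rangle,|\chi'\rangle$ (unit vectors of $\mathbb C^2$) if it is the line segment between the points of the Bloch sphere representing $|\chi\rangle$ and $|\chi'\rangle$ (a single point is allowed; this occurs exactly if $b=1$) and this segment is perpendicular to $\boldsymbol b$. If $\rho_B$ is non-degenerate, i.e. $\boldsymbol b\neq\boldsymbol 0$, the following are equivalent: (i) $\mathcal C(\rho)=\sqrt{1-b^2}$; (ii) $c_1=\sqrt{1-b^2}$; (iii) $\mathcal E_B$ is the perpendicular chord with ends $|\chi\rangle,|\chi'\rangle$ for some unit vectors $|\chi\rangle,|\chi'\rangle$. Moreover (for every $\boldsymbol b$), for given unit vectors $|\chi\rangle,|\chi'\rangle$, $\mathcal E_B$ is the perpendicular chord with these ends if and only if $$\rho=\tfrac12|\psi\rangle\langle\psi|\otimes|\chi\rangle\langle\chi|+\tfrac12|\bar\psi\rangle\langle\bar\psi|\otimes|\chi'\rangle\langle\chi'|$$ for some unit vectors $|\psi\rangle,|\bar\psi\rangle\in\mathbb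 C^2$ with $\langle\psi|\bar\psi\rangle=0$. -/

import Mathlib

open scoped Matrix Kronecker ComplexOrder

noncomputable section

namespace SteeredCoherence

/-- Operators on one qubit, in the computational basis. -/
abbrev QubitOp := Matrix (Fin 2) (Fin 2) ℂ

/-- Operators on two qubits; the first index is Alice's, the second one is Bob's. -/
abbrev TwoQubitOp := Matrix (Fin 2 × Fin 2) (Fin 2 × Fin 2) ℂ

/-- The Hilbert space of one qubit. -/
abbrev Qubit := EuclideanSpace ℂ (Fin 2)

/-- The space of Bloch vectors. -/
abbrev BlochSpace := EuclideanSpace ℝ (Fin 3)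

/-- A two-qubit state: a density matrix. -/
structure IsState (ρ : TwoQubitOp) : Prop where
  posSemidef : ρ.PosSemidef
  trace_eq_one : ρ.trace = 1

/-- The partial trace over Alice's qubit. -/
def traceA (X : TwoQubitOp) : QubitOp := fun i j => ∑ k, X (k, i) (k, j)

/-- The partial trace over Bob's qubit. -/
def traceB (X : TwoQubitOp) : QubitOp := fun i j => ∑ k, X (i, k) (j, k)

/-- A canonical state: a state for which Alice's marginal is maximally mixed. -/
structure IsCanonical (ρ : TwoQubitOp) : Prop extends IsState ρ where
  marginal : traceB ρ = (1 / 2 : ℂ) • (1 : QubitOp)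

/-- The Pauli matrices. -/
def pauli : Fin 3 → QubitOp :=
  ![!![0, 1; 1, 0], !![0, -Complex.I; Complex.I, 0], !![1, 0; 0, -1]]

/-- The Bloch vector of a one-qubit state, with coordinates `tr (σ σᵢ)`. -/
def blochVector (σ : QubitOp) : BlochSpace :=
  WithLp.toLp 2 fun i => ((σ * pauli i).trace).re

/-- The operator `|ψ⟩⟨ψ|`. -/
def proj (ψ : Qubit) : QubitOp := fun i j => ψ i * star (ψ j)

/-- Bob's Bloch vector. -/
def bobVector (ρ : TwoQubitOp) : BlochSpace := blochVector (traceA ρ)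

/-- `M` is an element of a POVM on Alice's qubit, i.e. `0 ≤ M ≤ 1`. -/
def IsPOVMElement (M : QubitOp) : Prop := M.PosSemidef ∧ (1 - M).PosSemidef

/-- The probability `p_M` of the outcome `M` on Alice's side. -/
def outcomeProb (ρ : TwoQubitOp) (M : QubitOp) : ℂ := ((M ⊗ₖ (1 : QubitOp)) * ρ).trace

/-- Bob's steered state after Alice's outcome `M`; used only when `p_M ≠ 0`. -/
def steeredState (ρ : TwoQubitOp) (M : QubitOp) : QubitOp :=
  (outcomeProb ρ M)⁻¹ • traceA ((M ⊗ₖ (1 : QubitOp)) * ρ)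

/-- The coherence of `σ` in the orthonormal basis `ξ`: the sum of the absolute values
of the off-diagonal elements. -/
def coherence (σ : QubitOp) (ξ : OrthonormalBasis (Fin 2) ℂ Qubit) : ℝ :=
  ∑ i, ∑ j, if i = j then 0 else ‖inner ℂ (ξ i) (Matrix.toEuclideanLin σ (ξ j))‖

/-- `ξ` is an eigenbasis of `σ`. -/
def IsEigenbasis (σ : QubitOp) (ξ : OrthonormalBasis (Fin 2) ℂ Qubit) : Prop :=
  ∀ i, ∃ μ : ℂ, Matrix.toEuclideanLin σ (ξ i) = μ • ξ i

/-- The coherences, in the basis `ξ`, of all states to which Alice can steer Bob. -/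
def steeredCoherences (ρ : TwoQubitOp) (ξ : OrthonormalBasis (Fin 2) ℂ Qubit) : Set ℝ :=
  {x | ∃ M, IsPOVMElement M ∧ outcomeProb ρ M ≠ 0 ∧ x = coherence (steeredState ρ M) ξ}

/-- The largest coherence, in the basis `ξ`, of a state to which Alice can steer Bob. -/
def maxCoherenceIn (ρ : TwoQubitOp) (ξ : OrthonormalBasis (Fin 2) ℂ Qubit) : ℝ :=
  sSup (steeredCoherences ρ ξ)

/-- The maximal steered coherence: the infimum of `maxCoherenceIn ρ ξ` over all eigenbases `ξ`
of Bob's reduced state. If that state is non-degenerate, then `ξ` is unique up to order and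
phases, on which `maxCoherenceIn ρ ξ` does not depend. -/
def maximalSteeredCoherence (ρ : TwoQubitOp) : ℝ :=
  ⨅ ξ : {ξ : OrthonormalBasis (Fin 2) ℂ Qubit // IsEigenbasis (traceA ρ) ξ},
    maxCoherenceIn ρ ξ.1

/-- Bob's steering ellipsoid: the Bloch vectors of all states to which Alice can steer Bob. -/
def steeringEllipsoid (ρ : TwoQubitOp) : Set BlochSpace :=
  {x | ∃ M, IsPOVMElement M ∧ outcomeProb ρ M ≠ 0 ∧ x = blochVector (steeredState ρ M)}

/-- `E` is a (solid, possibly degenerate) ellipsoid, and `c 0 ≥ c 1 ≥ c 2 ≥ 0` are the lengths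
of its semiaxes, which lie along the vectors of an orthonormal basis `u`. -/
def HasSemiaxes (E : Set BlochSpace) (c : Fin 3 → ℝ) : Prop :=
  Antitone c ∧ (∀ i, 0 ≤ c i) ∧
    ∃ (o : BlochSpace) (u : OrthonormalBasis (Fin 3) ℝ BlochSpace),
      E = {x | ∃ t : Fin 3 → ℝ, ∑ i, t i ^ 2 ≤ 1 ∧ x = o + ∑ i, (t i * c i) • u i}

/-- Bob's steering ellipsoid is the chord of the Bloch sphere between the pure states `χ` and
`χ'`, and it is perpendicular to Bob's Bloch vector. -/
def IsPerpChord (ρ : TwoQubitOp) (χ χ' : Qubit) : Prop :=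
  steeringEllipsoid ρ = segment ℝ (blochVector (proj χ)) (blochVector (proj χ')) ∧
    inner ℝ (bobVector ρ) (blochVector (proj χ) - blochVector (proj χ')) = 0

/-- `ρ = ½ |ψ⟩⟨ψ| ⊗ |χ⟩⟨χ| + ½ |φ⟩⟨φ| ⊗ |χ'⟩⟨χ'|` for some orthonormal `ψ`, `φ`. -/
def HasOptimalForm (ρ : TwoQubitOp) (χ χ' : Qubit) : Prop :=
  ∃ ψ φ : Qubit, ‖ψ‖ = 1 ∧ ‖φ‖ = 1 ∧ inner ℂ ψ φ = 0 ∧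
    ρ = (1 / 2 : ℂ) • (proj ψ ⊗ₖ proj χ) + (1 / 2 : ℂ) • (proj φ ⊗ₖ proj χ')

end SteeredCoherence

end

namespace SteeredCoherence


/-! Because Alice's marginal is maximally mixed, the probability of an outcome depends only on the
trace of `M`. Bob's steered Bloch vectors are therefore exactly b + A m with |m| ≤ 1, where A is
`steeringMap ρ`, and the ellipsoid is the image of a ball, centred at b. Its largest semiaxis is the
maximum of |A m|. In an eigenbasis of Bob's state, coherence is the distance from an axis through b,
hence at most |A m|; this gives C ≤ c₁.

For a unit vector e both b ± A e lie in the Bloch ball, and the parallelogram law yields |b|² + |A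
e|² ≤ 1, the second bound. In case of equality both points are pure states χ, χ', so the diagonal
blocks of ρ in Alice's basis ψ, φ are ½|χ⟩⟨χ| and ½|χ'⟩⟨χ'|. Positivity makes the off-diagonal block
a multiple x|χ⟩⟨χ'|, and the marginal condition makes it traceless: x⟨χ'|χ⟩ = 0. Orthogonal χ, χ'
would be antipodal with midpoint b = 0, so for b ≠ 0 the block vanishes
(`IsCanonical.eq_optimal_of_pure`).

A segment as ellipsoid means A m = ⟨n, m⟩d with |n| = 1; n encodes ψ, and b and A determine ρ, which
gives the normal form. At an end of a perpendicular chord A m is orthogonal to b, so the coherence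
is all of |A m| = √(1 - b²), and the chain of bounds collapses. -/

/-! ### Bloch vector calculus for one qubit -/

/-- The operator with trace `t` and Bloch vector `v`. -/
noncomputable def ofBloch (t : ℝ) (v : BlochSpace) : QubitOp :=
  (1 / 2 : ℂ) • !![(t : ℂ) + v 2, v 0 - Complex.I * v 1; v 0 + Complex.I * v 1, t - v 2]

lemma blochVector_ofBloch (t : ℝ) (v : BlochSpace) : blochVector (ofBloch t v) = v := by
  ext i
  fin_cases i <;>
    simp [blochVector, ofBloch, pauli, Matrix.trace_fin_two] <;> ring

lemma trace_ofBloch (t : ℝ) (v : BlochSpace) : (ofBloch t v).trace = t := by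
  simp [ofBloch, Matrix.trace_fin_two]
  ring

lemma eq_ofBloch {σ : QubitOp} (h : σ.IsHermitian) :
    σ = ofBloch σ.trace.re (blochVector σ) := by
  have h00 := h.apply 0 0
  have h11 := h.apply 1 1
  have h01 := h.apply 0 1
  simp [Complex.ext_iff] at h00 h11 h01
  ext i j
  fin_cases i <;> fin_cases j <;>
    simp [ofBloch, blochVector, pauli, Matrix.trace_fin_two, Matrix.mul_apply, Complex.ext_iff]
      <;> constructor <;> linarith

lemma smul_ofBloch (s t : ℝ) (v : BlochSpace) :
    (s : ℂ) • ofBloch t v = ofBloch (s * t) (s • v) := by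
  ext i j
  fin_cases i <;> fin_cases j <;> simp [ofBloch] <;> ring

lemma ofBloch_add (s t : ℝ) (v w : BlochSpace) :
    ofBloch s v + ofBloch t w = ofBloch (s + t) (v + w) := by
  ext i j
  fin_cases i <;> fin_cases j <;> simp [ofBloch] <;> ring

lemma one_sub_ofBloch (v : BlochSpace) : 1 - ofBloch 1 v = ofBloch 1 (-v) := by
  ext i j
  fin_cases i <;> fin_cases j <;> simp [ofBloch] <;> ring

lemma isHermitian_ofBloch (t : ℝ) (v : BlochSpace) : (ofBloch t v).IsHermitian := by
  ext i j
  fin_cases i <;> fin_cases j <;> simp [ofBloch] <;> ring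

lemma isHermitian_proj (ψ : Qubit) : (proj ψ).IsHermitian := by
  ext i j
  simp [proj, mul_comm]

lemma norm_sq_qubit (ψ : Qubit) : ‖ψ‖ ^ 2 = Complex.normSq (ψ 0) + Complex.normSq (ψ 1) := by
  simp [EuclideanSpace.norm_sq_eq, Complex.normSq_eq_norm_sq]

lemma proj_eq_ofBloch {ψ : Qubit} (h : ‖ψ‖ = 1) : proj ψ = ofBloch 1 (blochVector (proj ψ)) := by
  convert eq_ofBloch (isHermitian_proj ψ)
  have := norm_sq_qubit ψ
  rw [h] at this
  simp [Complex.normSq_apply] at this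
  simp [Matrix.trace_fin_two, proj]
  linarith

lemma norm_blochVector_proj {ψ : Qubit} (h : ‖ψ‖ = 1) : ‖blochVector (proj ψ)‖ = 1 := by
  have h1 := norm_sq_qubit ψ
  rw [h] at h1
  simp [Complex.normSq_apply] at h1
  have : ‖blochVector (proj ψ)‖ ^ 2 = 1 := by
    simp only [EuclideanSpace.norm_sq_eq, Fin.sum_univ_three, Real.norm_eq_abs, sq_abs]
    simp [blochVector, proj, pauli, Matrix.trace_fin_two, Matrix.mul_apply]
    linear_combination (-(ψ 0).re * (ψ 0).re - (ψ 0).im * (ψ 0).im -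
      (ψ 1).re * (ψ 1).re - (ψ 1).im * (ψ 1).im - 1) * h1
  nlinarith [norm_nonneg (blochVector (proj ψ))]

/-- Every point of the Bloch sphere represents a pure state. -/
lemma exists_blochVector_proj_eq {v : BlochSpace} (hv : ‖v‖ = 1) :
    ∃ ψ : Qubit, ‖ψ‖ = 1 ∧ blochVector (proj ψ) = v := by
  have h : v 0 ^ 2 + v 1 ^ 2 + v 2 ^ 2 = 1 := by
    have := EuclideanSpace.norm_sq_eq v
    simp [Fin.sum_univ_three, hv] at this
    linarith
  set z : ℂ := ⟨v 0, v 1⟩ with hz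
  have hzn : ‖z‖ ^ 2 = v 0 ^ 2 + v 1 ^ 2 := by
    rw [← Complex.normSq_eq_norm_sq, Complex.normSq_apply]; simp [hz]; ring
  have hp : 0 ≤ (1 + v 2) / 2 := by nlinarith
  have hm : 0 ≤ (1 - v 2) / 2 := by nlinarith
  -- The witness is (cos θ/2, e sin θ/2) with e the phase of v₀ + i v₁; at the poles `arg 0 = 0`
  -- gives e = 1, which serves as well.
  set e : ℂ := Complex.exp (Complex.arg z * Complex.I) with he
  have hen : e.re * e.re + e.im * e.im = 1 := by
    rw [← Complex.normSq_apply, Complex.normSq_eq_norm_sq, he, Complex.norm_exp_ofReal_mul_I]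
    norm_num
  have hze : (‖z‖ : ℂ) * e = z := Complex.norm_mul_exp_arg_mul_I z
  set α := √((1 + v 2) / 2) with hα
  set β := √((1 - v 2) / 2) with hβ
  have hα2 : α * α = (1 + v 2) / 2 := Real.mul_self_sqrt hp
  have hβ2 : β * β = (1 - v 2) / 2 := Real.mul_self_sqrt hm
  have hαβ : 2 * (α * β) = ‖z‖ := by
    rw [← sq_eq_sq₀ (by positivity) (norm_nonneg _), hzn]
    linear_combination 4 * β * β * hα2 + 2 * (1 + v 2) * hβ2 - h
  have hre : ‖z‖ * e.re = v 0 := by simpa using congrArg Complex.re hze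
  have him : ‖z‖ * e.im = v 1 := by simpa using congrArg Complex.im hze
  refine ⟨!₂[(α : ℂ), (β : ℂ) * e], ?_, ?_⟩
  · have := norm_sq_qubit !₂[(α : ℂ), (β : ℂ) * e]
    simp [Complex.normSq_apply (e), -map_mul, Complex.normSq_mul] at this
    rw [hen, hα2, hβ2] at this
    nlinarith [norm_nonneg (!₂[(α : ℂ), (β : ℂ) * e])]
  · ext i
    fin_cases i <;> simp [blochVector, proj, pauli, Matrix.trace_fin_two, Matrix.mul_apply]
    · linear_combination hre + e.re * hαβ
    · linear_combination him + e.im * hαβ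
    · linear_combination hα2 - hβ2 - β * β * hen

/-- The qubit orthogonal to `ψ`. -/
noncomputable def perp (ψ : Qubit) : Qubit := !₂[-star (ψ 1), star (ψ 0)]

lemma norm_perp (ψ : Qubit) : ‖perp ψ‖ = ‖ψ‖ := by
  rw [← sq_eq_sq₀ (norm_nonneg _) (norm_nonneg _), norm_sq_qubit, norm_sq_qubit]
  simp [perp, add_comm]

lemma inner_perp (ψ : Qubit) : inner ℂ ψ (perp ψ) = 0 := by
  simp [perp, PiLp.inner_apply]; ring

lemma blochVector_proj_perp (ψ : Qubit) :
    blochVector (proj (perp ψ)) = -blochVector (proj ψ) := by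
  ext i
  fin_cases i <;> simp [blochVector, proj, pauli, perp, Matrix.trace_fin_two, Matrix.mul_apply] <;>
    ring

lemma inner_qubit (ψ φ : Qubit) : inner ℂ ψ φ = star (ψ 0) * φ 0 + star (ψ 1) * φ 1 := by
  simp [PiLp.inner_apply]; ring

lemma proj_add_proj {ψ φ : Qubit} (hψ : ‖ψ‖ = 1) (hφ : ‖φ‖ = 1) (h : inner ℂ ψ φ = 0) :
    proj ψ + proj φ = 1 := by
  have hψ' := inner_self_eq_norm_sq_to_K (𝕜 := ℂ) ψ
  have hφ' := inner_self_eq_norm_sq_to_K (𝕜 := ℂ) φ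
  have h' : inner ℂ φ ψ = 0 := inner_eq_zero_symm.mp h
  rw [inner_qubit] at hψ' hφ' h h'
  set U : QubitOp := !![ψ 0, φ 0; ψ 1, φ 1] with hU
  have hUU : Uᴴ * U = 1 := by
    ext i j
    fin_cases i <;> fin_cases j
    · simpa [hU, Matrix.mul_apply, hψ] using hψ'
    · simpa [hU, Matrix.mul_apply] using h
    · simpa [hU, Matrix.mul_apply] using h'
    · simpa [hU, Matrix.mul_apply, hφ] using hφ'
  -- A left inverse of a square matrix is a right inverse, and U Uᴴ is the sum of the two
  -- projections.
  rw [mul_eq_one_comm] at hUU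
  rw [← hUU]
  ext i j
  fin_cases i <;> fin_cases j <;> simp [proj, hU, Matrix.mul_apply]

lemma blochVector_proj_orthogonal {ψ φ : Qubit} (hψ : ‖ψ‖ = 1) (hφ : ‖φ‖ = 1)
    (h : inner ℂ ψ φ = 0) : blochVector (proj φ) = -blochVector (proj ψ) := by
  rw [eq_sub_of_add_eq' (proj_add_proj hψ hφ h), proj_eq_ofBloch hψ, one_sub_ofBloch]
  simp only [blochVector_ofBloch]

/-- The expectation value of an operator in a pure state, in terms of Bloch vectors. -/
lemma star_dotProduct_ofBloch_mulVec (t : ℝ) (v : BlochSpace) {χ : Qubit} (hχ : ‖χ‖ = 1) :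
    star (χ : Fin 2 → ℂ) ⬝ᵥ (ofBloch t v *ᵥ (χ : Fin 2 → ℂ)) =
      ((t + inner ℝ v (blochVector (proj χ))) / 2 : ℝ) := by
  have h1 := norm_sq_qubit χ
  rw [hχ] at h1
  simp [Complex.normSq_apply] at h1
  simp [ofBloch, blochVector, proj, pauli, Matrix.trace_fin_two, Matrix.mul_apply,
    dotProduct, Matrix.mulVec, PiLp.inner_apply, Fin.sum_univ_three, Complex.ext_iff]
  constructor
  · linear_combination (-t / 2) * h1
  · ring
-- With τ = σ Hermitian this is |⟨x|σ|y⟩|² as a trace, free of phases and computable from Bloch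
-- vectors.
lemma trace_proj_mul (x y : Qubit) (σ τ : QubitOp) :
    (proj x * σ * proj y * τ).trace =
      inner ℂ x (Matrix.toEuclideanLin σ y) * inner ℂ y (Matrix.toEuclideanLin τ x) := by
  simp [inner_qubit, Matrix.trace_fin_two, Matrix.mul_apply, proj, Matrix.toLpLin_apply]
  ring

lemma inner_toEuclideanLin_ofBloch_comm (t : ℝ) (v : BlochSpace) (x y : Qubit) :
    inner ℂ y (Matrix.toEuclideanLin (ofBloch t v) x) =
      star (inner ℂ x (Matrix.toEuclideanLin (ofBloch t v) y)) := by
  simp [inner_qubit, ofBloch, Matrix.toLpLin_apply, dotProduct]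
  ring

/-- The coherence in terms of Bloch vectors: the distance of the Bloch vector from the axis of
the basis. -/
lemma coherence_ofBloch (t : ℝ) (v : BlochSpace) (ξ : OrthonormalBasis (Fin 2) ℂ Qubit) :
    coherence (ofBloch t v) ξ =
      √(‖v‖ ^ 2 - inner ℝ v (blochVector (proj (ξ 0))) ^ 2) := by
  have h0 : ‖ξ 0‖ = 1 := ξ.orthonormal.1 0
  have h1 : ‖ξ 1‖ = 1 := ξ.orthonormal.1 1
  have h01 : inner ℂ (ξ 0) (ξ 1) = 0 := ξ.orthonormal.2 (by decide)
  have htr := trace_proj_mul (ξ 0) (ξ 1) (ofBloch t v) (ofBloch t v)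
  rw [inner_toEuclideanLin_ofBloch_comm t v (ξ 0) (ξ 1), proj_eq_ofBloch h0, proj_eq_ofBloch h1,
    blochVector_proj_orthogonal h0 h1 h01, Complex.star_def, Complex.mul_conj,
    Complex.normSq_eq_norm_sq] at htr
  have hn := norm_blochVector_proj h0
  set n := blochVector (proj (ξ 0))
  have hn2 : n 0 ^ 2 + n 1 ^ 2 + n 2 ^ 2 = 1 := by
    have := EuclideanSpace.norm_sq_eq n
    simp [Fin.sum_univ_three, hn] at this
    linarith
  have hv2 : ‖v‖ ^ 2 = v 0 ^ 2 + v 1 ^ 2 + v 2 ^ 2 := by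
    simp [EuclideanSpace.norm_sq_eq, Fin.sum_univ_three]
  have hin : inner ℝ v n = v 0 * n 0 + v 1 * n 1 + v 2 * n 2 := by
    simp [PiLp.inner_apply, Fin.sum_univ_three]; ring
  have key : 4 * (ofBloch 1 n * ofBloch t v * ofBloch 1 (-n) * ofBloch t v).trace =
      ((‖v‖ ^ 2 - inner ℝ v n ^ 2 : ℝ) : ℂ) := by
    rw [hv2, hin]
    apply Complex.ext
    · simp [Matrix.trace_fin_two, ofBloch, pow_two]
      linear_combination (1 / 2) * (v 0 ^ 2 + v 1 ^ 2 + v 2 ^ 2 - t ^ 2) * hn2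
    · simp [Matrix.trace_fin_two, ofBloch, pow_two]
      ring
  rw [htr] at key
  have key' : 4 * ‖inner ℂ (ξ 0) (Matrix.toEuclideanLin (ofBloch t v) (ξ 1))‖ ^ 2 =
      ‖v‖ ^ 2 - inner ℝ v n ^ 2 := by exact_mod_cast key
  rw [← key']
  have : coherence (ofBloch t v) ξ =
      2 * ‖inner ℂ (ξ 0) (Matrix.toEuclideanLin (ofBloch t v) (ξ 1))‖ := by
    simp only [coherence, Fin.sum_univ_two]
    rw [inner_toEuclideanLin_ofBloch_comm t v (ξ 0) (ξ 1), norm_star]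
    simp; ring
  rw [this, eq_comm, Real.sqrt_eq_iff_mul_self_eq (by positivity) (by positivity)]
  ring


/-! ### Steering as an affine map of the Bloch ball -/

/-- Bob's unnormalized state after Alice's outcome `M`. -/
lemma traceA_kronecker_mul_apply (ρ : TwoQubitOp) (M : QubitOp) (k l : Fin 2) :
    traceA ((M ⊗ₖ (1 : QubitOp)) * ρ) k l = ∑ i, ∑ j, M i j * ρ (j, k) (i, l) := by
  simp only [traceA, Matrix.mul_apply, Fintype.sum_prod_type, Matrix.kroneckerMap_apply]
  fin_cases k <;> simp [Matrix.one_apply]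

lemma traceA_kronecker_mul_conjTranspose {ρ : TwoQubitOp} (hρ : ρ.IsHermitian) (M : QubitOp) :
    (traceA ((M ⊗ₖ (1 : QubitOp)) * ρ))ᴴ = traceA ((Mᴴ ⊗ₖ (1 : QubitOp)) * ρ) := by
  ext k l
  simp only [Matrix.conjTranspose_apply, traceA_kronecker_mul_apply, star_sum, star_mul', hρ.apply]
  rw [Finset.sum_comm]

lemma trace_traceA (X : TwoQubitOp) : (traceA X).trace = X.trace := by
  simp only [traceA, Matrix.trace, Matrix.diag, Fintype.sum_prod_type]
  rw [Finset.sum_comm]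

lemma trace_kronecker_mul (ρ : TwoQubitOp) (M : QubitOp) :
    ((M ⊗ₖ (1 : QubitOp)) * ρ).trace = (M * traceB ρ).trace := by
  simp [Matrix.trace, Matrix.mul_apply, Fintype.sum_prod_type, Matrix.one_apply, traceB, mul_add]
  ring

/-- The marginal condition enters the proof here: outcome probabilities do not see the Bloch vector
of `M`. -/
lemma IsCanonical.trace_kronecker_mul {ρ : TwoQubitOp} (hρ : IsCanonical ρ) (M : QubitOp) :
    ((M ⊗ₖ (1 : QubitOp)) * ρ).trace = M.trace / 2 := by
  rw [SteeredCoherence.trace_kronecker_mul, hρ.marginal]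
  simp
  ring

/-- Operators on two qubits are determined by the states to which Alice can steer Bob. -/
lemma ext_of_traceA_ofBloch {ρ τ : TwoQubitOp}
    (h : ∀ t v, traceA ((ofBloch t v ⊗ₖ (1 : QubitOp)) * ρ) =
      traceA ((ofBloch t v ⊗ₖ (1 : QubitOp)) * τ)) : ρ = τ := by
  ext ⟨i, k⟩ ⟨j, l⟩
  -- These four operators are half the identity and half the Pauli matrices, a basis of Alice's
  -- operators.
  have h1 := congrFun₂ (h 1 0) k l
  have h2 := congrFun₂ (h 0 (EuclideanSpace.single 0 1)) k l
  have h3 := congrFun₂ (h 0 (EuclideanSpace.single 1 1)) k l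
  have h4 := congrFun₂ (h 0 (EuclideanSpace.single 2 1)) k l
  simp [traceA_kronecker_mul_apply, ofBloch] at h1 h2 h3 h4
  have hI := Complex.I_sq
  fin_cases i <;> fin_cases j <;> simp
  · linear_combination h1 + h4
  · linear_combination h2 - Complex.I * h3 + (1 / 2) *
      (ρ (0, k) (1, l) - ρ (1, k) (0, l) - τ (0, k) (1, l) + τ (1, k) (0, l)) * hI
  · linear_combination h2 + Complex.I * h3 - (1 / 2) *
      (ρ (0, k) (1, l) - ρ (1, k) (0, l) - τ (0, k) (1, l) + τ (1, k) (0, l)) * hI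
  · linear_combination h1 - h4

/-- The linear part of the map taking the Bloch vector of Alice's measurement operator to the Bloch
vector of Bob's steered state. -/
noncomputable def steeringMap (ρ : TwoQubitOp) : BlochSpace →ₗ[ℝ] BlochSpace :=
  Matrix.toEuclideanLin
    (Matrix.of fun j i : Fin 3 => ((pauli i ⊗ₖ pauli j) * ρ).trace.re)

lemma blochVector_traceA (ρ : TwoQubitOp) (t : ℝ) (m : BlochSpace) :
    blochVector (traceA ((ofBloch t m ⊗ₖ (1 : QubitOp)) * ρ)) =
      (1 / 2 : ℝ) • (t • bobVector ρ + steeringMap ρ m) := by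
  ext j
  simp only [blochVector, Matrix.mul_apply, Fin.sum_univ_two, bobVector, steeringMap,
    PiLp.smul_apply, PiLp.add_apply,
    Matrix.toLpLin_apply, Matrix.mulVec, dotProduct, Fin.sum_univ_three, Matrix.of_apply, traceA,
    Matrix.trace, Matrix.diag, Fintype.sum_prod_type, Matrix.kroneckerMap_apply]
  fin_cases j <;> simp [pauli, ofBloch] <;> ring

lemma IsCanonical.traceA_ofBloch {ρ : TwoQubitOp} (hρ : IsCanonical ρ) (t : ℝ) (m : BlochSpace) :
    traceA ((ofBloch t m ⊗ₖ (1 : QubitOp)) * ρ) =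
      ofBloch (t / 2) ((1 / 2 : ℝ) • (t • bobVector ρ + steeringMap ρ m)) := by
  have h : (traceA ((ofBloch t m ⊗ₖ (1 : QubitOp)) * ρ)).IsHermitian := by
    rw [Matrix.IsHermitian, traceA_kronecker_mul_conjTranspose hρ.posSemidef.isHermitian,
      (isHermitian_ofBloch t m).eq]
  rw [eq_ofBloch h, blochVector_traceA, trace_traceA, hρ.trace_kronecker_mul, trace_ofBloch]
  norm_num

lemma IsCanonical.traceA_eq {ρ : TwoQubitOp} (hρ : IsCanonical ρ) :
    traceA ρ = ofBloch 1 (bobVector ρ) := by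
  have h := hρ.traceA_ofBloch 2 0
  have h1 : ofBloch 2 0 = 1 := by
    ext i j
    fin_cases i <;> fin_cases j <;> simp [ofBloch]
  simpa [h1] using h

/-- Expectations in product vectors carry positivity of ρ over to Bob's operators. -/
lemma expectation_kronecker (ρ : TwoQubitOp) (ψ χ : Qubit) :
    star (χ : Fin 2 → ℂ) ⬝ᵥ (traceA ((proj ψ ⊗ₖ (1 : QubitOp)) * ρ) *ᵥ (χ : Fin 2 → ℂ)) =
      star (fun p : Fin 2 × Fin 2 => ψ p.1 * χ p.2) ⬝ᵥ (ρ *ᵥ fun p => ψ p.1 * χ p.2) := by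
  simp [dotProduct, Matrix.mulVec, Fintype.sum_prod_type, traceA_kronecker_mul_apply, proj]
  ring

/-- Bob's steered states lie in the Bloch ball. -/
lemma IsCanonical.norm_add_steeringMap_le_one {ρ : TwoQubitOp} (hρ : IsCanonical ρ)
    {m : BlochSpace} (hm : ‖m‖ = 1) : ‖bobVector ρ + steeringMap ρ m‖ ≤ 1 := by
  by_contra! hlt
  set v := bobVector ρ + steeringMap ρ m with hv
  have hv0 : ‖v‖ ≠ 0 := by linarith
  obtain ⟨ψ, hψ, rfl⟩ := exists_blochVector_proj_eq hm
  -- For χ antipodal to v the expectation in ψ ⊗ χ is (1 - |v|)/4, negative if |v| > 1.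
  obtain ⟨χ, hχ, hχv⟩ := exists_blochVector_proj_eq (v := -(‖v‖⁻¹ • v)) (by
    rw [norm_neg, norm_smul, norm_inv, norm_norm, inv_mul_cancel₀ hv0])
  have h := expectation_kronecker ρ ψ χ
  rw [proj_eq_ofBloch hψ, hρ.traceA_ofBloch, one_smul, ← hv,
    star_dotProduct_ofBloch_mulVec _ _ hχ, hχv] at h
  have h0 := hρ.posSemidef.dotProduct_mulVec_nonneg fun p => ψ p.1 * χ p.2
  rw [← h, Complex.zero_le_real, inner_smul_left, inner_neg_right, inner_smul_right,
    real_inner_self_eq_norm_sq, pow_two, inv_mul_cancel_left₀ hv0] at h0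
  norm_num at h0
  linarith

lemma exists_norm_eq_smul (m : BlochSpace) : ∃ e : BlochSpace, ‖e‖ = 1 ∧ m = ‖m‖ • e := by
  by_cases h : m = 0
  · exact ⟨EuclideanSpace.single 0 1, by simp, by simp [h]⟩
  · have := norm_ne_zero_iff.mpr h
    exact ⟨‖m‖⁻¹ • m, by rw [norm_smul, norm_inv, norm_norm, inv_mul_cancel₀ this],
      by rw [smul_smul, mul_inv_cancel₀ this, one_smul]⟩

lemma posSemidef_proj (ψ : Qubit) : (proj ψ).PosSemidef :=
  Matrix.posSemidef_vecMulVec_self_star (ψ : Fin 2 → ℂ)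

/-- The eigenvalues are (t ± |v|)/2. The smaller one is the expectation in the state antipodal to v.
-/
lemma posSemidef_ofBloch_iff {t : ℝ} {v : BlochSpace} : (ofBloch t v).PosSemidef ↔ ‖v‖ ≤ t := by
  obtain ⟨e, he, hv⟩ := exists_norm_eq_smul v
  constructor
  · intro h
    obtain ⟨χ, hχ, hχe⟩ := exists_blochVector_proj_eq (v := -e) (by simpa)
    have h0 := h.dotProduct_mulVec_nonneg χ
    rw [star_dotProduct_ofBloch_mulVec _ _ hχ, hχe, Complex.zero_le_real, hv, inner_smul_left,
      inner_neg_right, real_inner_self_eq_norm_sq, he] at h0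
    norm_num at h0
    linarith
  · intro h
    obtain ⟨χ, hχ, hχe⟩ := exists_blochVector_proj_eq he
    have h1 : ofBloch t v = ((t - ‖v‖ : ℝ) / 2 : ℂ) • (1 : QubitOp) + (‖v‖ : ℂ) • proj χ := by
      rw [proj_eq_ofBloch hχ, hχe, smul_ofBloch, ← hv]
      ext i j
      fin_cases i <;> fin_cases j <;> simp [ofBloch] <;> ring
    rw [h1]
    refine (Matrix.PosSemidef.one.smul ?_).add ((posSemidef_proj χ).smul ?_)
    · rw [← Complex.ofReal_ofNat, ← Complex.ofReal_div, Complex.zero_le_real]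
      linarith
    · simp

lemma isPOVMElement_ofBloch {m : BlochSpace} (hm : ‖m‖ ≤ 1) : IsPOVMElement (ofBloch 1 m) := by
  refine ⟨posSemidef_ofBloch_iff.mpr hm, ?_⟩
  rw [one_sub_ofBloch]
  exact posSemidef_ofBloch_iff.mpr (by rwa [norm_neg])

lemma IsCanonical.outcomeProb_ofBloch {ρ : TwoQubitOp} (hρ : IsCanonical ρ) (t : ℝ)
    (m : BlochSpace) : outcomeProb ρ (ofBloch t m) = (t / 2 : ℝ) := by
  rw [outcomeProb, hρ.trace_kronecker_mul, trace_ofBloch]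
  norm_num

lemma IsCanonical.steeredState_ofBloch {ρ : TwoQubitOp} (hρ : IsCanonical ρ) {t : ℝ} (ht : t ≠ 0)
    (m : BlochSpace) :
    steeredState ρ (ofBloch t m) = ofBloch 1 (bobVector ρ + steeringMap ρ (t⁻¹ • m)) := by
  rw [steeredState, hρ.outcomeProb_ofBloch, hρ.traceA_ofBloch, ← Complex.ofReal_inv, smul_ofBloch,
    inv_mul_cancel₀ (by positivity), smul_smul, smul_add, smul_smul, map_smul]
  congr 2
  · convert one_smul ℝ _
    field_simp
  · congr 1
    field_simp

/-- Steered states are unchanged by rescaling `M`, so trace one suffices; there 0 ≤ M ≤ 1 just says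
that the Bloch vector lies in the unit ball. The predicate `P` lets this serve both the ellipsoid
and the coherences. -/
lemma IsCanonical.exists_steeredState_iff {ρ : TwoQubitOp} (hρ : IsCanonical ρ)
    (P : QubitOp → Prop) :
    (∃ M, IsPOVMElement M ∧ outcomeProb ρ M ≠ 0 ∧ P (steeredState ρ M)) ↔
      ∃ m : BlochSpace, ‖m‖ ≤ 1 ∧ P (ofBloch 1 (bobVector ρ + steeringMap ρ m)) := by
  constructor
  · rintro ⟨M, hM, hp, hP⟩
    have hM' := eq_ofBloch hM.1.isHermitian
    set t := M.trace.re
    set m := blochVector M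
    rw [hM', hρ.outcomeProb_ofBloch] at hp
    have ht : t ≠ 0 := by
      rintro h
      simp [h] at hp
    have hm : ‖m‖ ≤ t := posSemidef_ofBloch_iff.mp (hM' ▸ hM.1)
    have ht' : 0 < t := lt_of_le_of_ne ((norm_nonneg m).trans hm) ht.symm
    rw [hM', hρ.steeredState_ofBloch ht] at hP
    refine ⟨t⁻¹ • m, ?_, hP⟩
    rw [norm_smul, norm_inv, Real.norm_of_nonneg ht'.le, inv_mul_le_iff₀ ht', mul_one]
    exact hm
  · rintro ⟨m, hm, hP⟩
    refine ⟨ofBloch 1 m, isPOVMElement_ofBloch hm, ?_, ?_⟩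
    · rw [hρ.outcomeProb_ofBloch]
      norm_num
    · rw [hρ.steeredState_ofBloch one_ne_zero, inv_one, one_smul]
      exact hP

lemma IsCanonical.mem_steeringEllipsoid_iff {ρ : TwoQubitOp} (hρ : IsCanonical ρ)
    {x : BlochSpace} :
    x ∈ steeringEllipsoid ρ ↔ ∃ m : BlochSpace, ‖m‖ ≤ 1 ∧ x = bobVector ρ + steeringMap ρ m := by
  have h := hρ.exists_steeredState_iff fun σ => x = blochVector σ
  simp only [blochVector_ofBloch] at h
  exact h

lemma IsCanonical.steeredCoherences_eq {ρ : TwoQubitOp} (hρ : IsCanonical ρ)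
    (ξ : OrthonormalBasis (Fin 2) ℂ Qubit) :
    steeredCoherences ρ ξ = (fun m => coherence (ofBloch 1 (bobVector ρ + steeringMap ρ m)) ξ) ''
      Metric.closedBall 0 1 := by
  ext x
  refine (hρ.exists_steeredState_iff fun σ => x = coherence σ ξ).trans ?_
  simp [eq_comm]


/-! ### Affine images of the unit ball: semiaxes and segments -/

section Ellipsoid

/-- The image of the unit ball under an affine map is an ellipsoid. -/
lemma exists_hasSemiaxes (A : BlochSpace →ₗ[ℝ] BlochSpace) (o : BlochSpace) :
    ∃ c, HasSemiaxes {x | ∃ m : BlochSpace, ‖m‖ ≤ 1 ∧ x = o + A m} c := by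
  -- Singular value decomposition: the axes are eigenvectors uᵢ of A Aᵀ, the semiaxes are the roots
  -- of the eigenvalues, and the wᵢ = Aᵀuᵢ are orthogonal with |wᵢ| = cᵢ.
  have hS : (A ∘ₗ LinearMap.adjoint A).IsSymmetric := by
    intro x y
    simp [← LinearMap.adjoint_inner_right]
  have hn : Module.finrank ℝ BlochSpace = 3 := by simp
  set u := hS.eigenvectorBasis hn with hu
  set μ := hS.eigenvalues hn with hμ
  set w : Fin 3 → BlochSpace := fun i => LinearMap.adjoint A (u i) with hw
  have huw : ∀ i m, inner ℝ (u i) (A m) = inner ℝ (w i) m := fun i m => by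
    rw [hw, LinearMap.adjoint_inner_left]
  have hAw : ∀ i, A (w i) = μ i • u i := fun i => hS.apply_eigenvectorBasis hn i
  have hww : ∀ i j, inner ℝ (w i) (w j) = if i = j then μ j else 0 := fun i j => by
    rw [← huw, hAw, inner_smul_right, orthonormal_iff_ite.mp u.orthonormal i j]
    simp
  have hμ0 : ∀ i, 0 ≤ μ i := fun i => by
    have := hww i i
    rw [if_pos rfl, real_inner_self_eq_norm_sq] at this
    rw [← this]
    positivity
  set c : Fin 3 → ℝ := fun i => √(μ i) with hc
  have hc2 : ∀ i, c i ^ 2 = μ i := fun i => Real.sq_sqrt (hμ0 i)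
  have hexp : ∀ m, A m = ∑ i, inner ℝ (w i) m • u i := fun m => by
    simp only [← huw, u.sum_repr']
  have hsum : ∀ (a : Fin 3 → ℝ) j, inner ℝ (w j) (∑ i, a i • w i) = a j * c j ^ 2 := fun a j => by
    simp [inner_sum, inner_smul_right, hww, hc2]
  have hnorm : ∀ a : Fin 3 → ℝ, ‖∑ i, a i • w i‖ ^ 2 = ∑ i, (a i * c i) ^ 2 := fun a => by
    rw [← real_inner_self_eq_norm_sq, sum_inner]
    refine Finset.sum_congr rfl fun i _ => ?_
    rw [inner_smul_left, hsum]
    simp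
    ring
  refine ⟨c, fun i j hij => Real.sqrt_le_sqrt (hS.eigenvalues_antitone hn hij),
    fun i => Real.sqrt_nonneg _, o, u, Set.ext fun x => ⟨?_, ?_⟩⟩
  · rintro ⟨m, hm, rfl⟩
    -- If cᵢ = 0 then wᵢ = 0, so division by zero does no harm.
    have ht : ∀ i, inner ℝ (w i) m / c i * c i = inner ℝ (w i) m := fun i => by
      by_cases h : c i = 0
      · have h1 := hww i i
        rw [if_pos rfl, ← hc2, h, zero_pow two_ne_zero, inner_self_eq_zero] at h1
        simp [h1]
      · exact div_mul_cancel₀ _ h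
    refine ⟨fun i => inner ℝ (w i) m / c i, ?_, ?_⟩
    -- Bessel's inequality: the sum is the orthogonal projection of m onto the span of the wᵢ.
    · have h1 := hnorm fun i => inner ℝ (w i) m / c i / c i
      have h2 : inner ℝ m (∑ i, (inner ℝ (w i) m / c i / c i) • w i) =
          ∑ i, (inner ℝ (w i) m / c i) ^ 2 := by
        rw [inner_sum]
        refine Finset.sum_congr rfl fun i _ => ?_
        rw [inner_smul_right, real_inner_comm]
        ring
      have h3 : ∑ i, (inner ℝ (w i) m / c i / c i * c i) ^ 2 =
          ∑ i, (inner ℝ (w i) m / c i) ^ 2 := by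
        refine Finset.sum_congr rfl fun i _ => ?_
        congr 1
        rw [div_mul_eq_mul_div, ht]
      have h4 := norm_sub_sq_real m (∑ i, (inner ℝ (w i) m / c i / c i) • w i)
      rw [h1, h2, h3] at h4
      nlinarith [sq_nonneg ‖m - ∑ i, (inner ℝ (w i) m / c i / c i) • w i‖, norm_nonneg m]
    · simp only [ht, ← hexp]
  · rintro ⟨t, ht, rfl⟩
    -- Since A wᵢ = cᵢ² uᵢ, the coefficient tᵢ/cᵢ produces tᵢcᵢuᵢ.
    refine ⟨∑ i, (t i / c i) • w i, ?_, ?_⟩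
    · have h1 := hnorm fun i => t i / c i
      have h2 : ∑ i, (t i / c i * c i) ^ 2 ≤ ∑ i, t i ^ 2 := by
        refine Finset.sum_le_sum fun i _ => ?_
        by_cases h : c i = 0
        · simp [h, sq_nonneg]
        · rw [div_mul_cancel₀ _ h]
      rw [← sq_le_one_iff₀ (norm_nonneg _)]
      linarith
    · rw [hexp]
      congr 1
      refine Finset.sum_congr rfl fun i _ => ?_
      rw [hsum]
      congr 1
      by_cases h : c i = 0
      · simp [h]
      · field_simp

variable {A : BlochSpace →ₗ[ℝ] BlochSpace} {o : BlochSpace} {c : Fin 3 → ℝ}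

lemma norm_sq_sum_smul (u : OrthonormalBasis (Fin 3) ℝ BlochSpace) (a : Fin 3 → ℝ) :
    ‖∑ i, a i • u i‖ ^ 2 = ∑ i, a i ^ 2 := by
  rw [← real_inner_self_eq_norm_sq, u.orthonormal.inner_sum]
  simp [pow_two]

/-- The largest semiaxis bounds the linear part of the map producing the ellipsoid. -/
lemma HasSemiaxes.norm_map_le
    (h : HasSemiaxes {x | ∃ m : BlochSpace, ‖m‖ ≤ 1 ∧ x = o + A m} c)
    {m : BlochSpace} (hm : ‖m‖ ≤ 1) : ‖A m‖ ≤ c 0 := by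
  obtain ⟨hc, hc0, p, u, hE⟩ := h
  have h1 : o + A m ∈ {x | ∃ m : BlochSpace, ‖m‖ ≤ 1 ∧ x = o + A m} := ⟨m, hm, rfl⟩
  have h2 : o + A (-m) ∈ {x | ∃ m : BlochSpace, ‖m‖ ≤ 1 ∧ x = o + A m} :=
    ⟨-m, by rwa [norm_neg], rfl⟩
  rw [hE] at h1 h2
  obtain ⟨t, ht, h1⟩ := h1
  obtain ⟨s, hs, h2⟩ := h2
  -- Subtracting the images of m and -m eliminates both o and p, which are not known to coincide.
  have h3 : (2 : ℝ) • A m = ∑ i, ((t i - s i) * c i) • u i := by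
    have : (2 : ℝ) • A m = (o + A m) - (o + A (-m)) := by rw [map_neg]; module
    rw [this, h1, h2, add_sub_add_left_eq_sub, ← Finset.sum_sub_distrib]
    simp only [sub_mul, sub_smul]
  have h4 : (2 * ‖A m‖) ^ 2 ≤ (2 * c 0) ^ 2 := by
    have h5 : ‖(2 : ℝ) • A m‖ = 2 * ‖A m‖ := by rw [norm_smul]; norm_num
    rw [← h5, h3, norm_sq_sum_smul]
    calc ∑ i, ((t i - s i) * c i) ^ 2 ≤ ∑ i, (2 * t i ^ 2 + 2 * s i ^ 2) * c 0 ^ 2 := by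
          refine Finset.sum_le_sum fun i _ => ?_
          rw [mul_pow]
          have := hc0 i
          have := hc (Fin.zero_le i)
          gcongr
          nlinarith [sq_nonneg (t i + s i)]
      _ = (2 * ∑ i, t i ^ 2 + 2 * ∑ i, s i ^ 2) * c 0 ^ 2 := by
          rw [← Finset.sum_mul, Finset.sum_add_distrib, Finset.mul_sum, Finset.mul_sum]
      _ ≤ (2 * 1 + 2 * 1) * c 0 ^ 2 := by gcongr
      _ = _ := by ring
  have := hc0 0
  linarith [le_of_sq_le_sq h4 (by positivity)]

/-- Half the difference of preimages of the ends of the longest axis attains the bound. With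
`HasSemiaxes.norm_map_le`, `c 0` is the operator norm of A, whichever axes are chosen. -/
lemma HasSemiaxes.exists_norm_map_eq
    (h : HasSemiaxes {x | ∃ m : BlochSpace, ‖m‖ ≤ 1 ∧ x = o + A m} c) :
    ∃ m : BlochSpace, ‖m‖ ≤ 1 ∧ ‖A m‖ = c 0 := by
  obtain ⟨-, hc0, p, u, hE⟩ := h
  have hmem : ∀ s : ℝ, s ^ 2 ≤ 1 → ∃ m : BlochSpace, ‖m‖ ≤ 1 ∧ p + (s * c 0) • u 0 = o + A m := by
    intro s hs
    have : p + (s * c 0) • u 0 ∈ {x | ∃ m : BlochSpace, ‖m‖ ≤ 1 ∧ x = o + A m} := by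
      rw [hE]
      exact ⟨![s, 0, 0], by simpa [Fin.sum_univ_three] using hs, by simp [Fin.sum_univ_three]⟩
    exact this
  obtain ⟨m, hm, h1⟩ := hmem 1 (by norm_num)
  obtain ⟨m', hm', h2⟩ := hmem (-1) (by norm_num)
  refine ⟨(1 / 2 : ℝ) • (m - m'), ?_, ?_⟩
  · rw [norm_smul]
    norm_num
    linarith [norm_sub_le m m']
  · have h3 : A ((1 / 2 : ℝ) • (m - m')) = c 0 • u 0 := by
      have : A ((1 / 2 : ℝ) • (m - m')) = (1 / 2 : ℝ) • ((o + A m) - (o + A m')) := by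
        rw [map_smul, map_sub]; module
      rw [this, ← h1, ← h2]
      module
    rw [h3, norm_smul, u.orthonormal.1 0, Real.norm_of_nonneg (hc0 0), mul_one]

/-- If the image of the unit ball is a segment, its centre is the midpoint. -/
lemma eq_midpoint_of_ball_image_eq_segment {r r' : BlochSpace}
    (h : {x | ∃ m : BlochSpace, ‖m‖ ≤ 1 ∧ x = o + A m} = segment ℝ r r') :
    o = (1 / 2 : ℝ) • (r + r') := by
  have hsymm : ∀ x ∈ segment ℝ r r', (2 : ℝ) • o - x ∈ segment ℝ r r' := by
    rw [← h]
    rintro _ ⟨m, hm, rfl⟩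
    exact ⟨-m, by rwa [norm_neg], by rw [map_neg]; module⟩
  have h1 := hsymm r (left_mem_segment ℝ r r')
  have h2 := hsymm r' (right_mem_segment ℝ r r')
  rw [segment_eq_image'] at h1 h2
  obtain ⟨s, hs, hs'⟩ := h1
  obtain ⟨t, ht, ht'⟩ := h2
  simp only at hs' ht'
  -- The reflection in o keeps the segment. Comparing the images of the two ends forces s = 1, i.e.
  -- the ends are swapped, or r = r'.
  have h3 : (1 - (s - t)) • (r' - r) = 0 := by
    linear_combination (norm := module) ht' - hs'
  rcases smul_eq_zero.mp h3 with h4 | h4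
  · have : s = 1 := by linarith [hs.2, ht.1]
    subst this
    have : o = (1 / 2 : ℝ) • ((2 : ℝ) • o - r + r) := by module
    rw [this, ← hs']
    module
  · have : o = (1 / 2 : ℝ) • ((2 : ℝ) • o - r + r) := by module
    rw [this, ← hs', h4, sub_eq_zero.mp h4]
    module

/-- If the image of the unit ball is a segment, the linear part has rank at most one. -/
lemma exists_map_eq_inner_smul_of_ball_image_eq_segment {r r' : BlochSpace}
    (h : {x | ∃ m : BlochSpace, ‖m‖ ≤ 1 ∧ x = o + A m} = segment ℝ r r') :
    ∃ n : BlochSpace, ‖n‖ = 1 ∧ ∀ m, A m = inner ℝ n m • (1 / 2 : ℝ) • (r - r') := by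
  have ho := eq_midpoint_of_ball_image_eq_segment h
  set d := (1 / 2 : ℝ) • (r - r') with hd
  have hball : ∀ m, ‖m‖ ≤ 1 → ∃ s : ℝ, |s| ≤ 1 ∧ A m = s • d := by
    intro m hm
    have : o + A m ∈ segment ℝ r r' := h ▸ ⟨m, hm, rfl⟩
    rw [segment_eq_image'] at this
    obtain ⟨s, hs, hs'⟩ := this
    refine ⟨1 - 2 * s, abs_le.mpr ⟨by linarith [hs.2], by linarith [hs.1]⟩, ?_⟩
    rw [← sub_eq_iff_eq_add'] at hs'
    rw [← hs', ho, hd]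
    module
  by_cases hd0 : d = 0
  · refine ⟨EuclideanSpace.single 0 1, by simp, fun m => ?_⟩
    obtain ⟨e, he, hm⟩ := exists_norm_eq_smul m
    obtain ⟨s, -, hs⟩ := hball e he.le
    rw [hm, map_smul, hs, hd0]
    simp
  have hdn : ‖d‖ ≠ 0 := norm_ne_zero_iff.mpr hd0
  -- Pairing with n reads off the coefficient of d in A m. It has norm at most 1 as coefficients on
  -- the ball do, and at least 1 as the end r = o + d is attained.
  set n := (‖d‖ ^ 2)⁻¹ • LinearMap.adjoint A d with hn
  have hg : ∀ m (s : ℝ), A m = s • d → inner ℝ n m = s := fun m s hs => by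
    rw [hn, inner_smul_left, LinearMap.adjoint_inner_left, hs, inner_smul_right,
      real_inner_self_eq_norm_sq]
    simp
    field_simp
  have hA : ∀ m, A m = inner ℝ n m • d := fun m => by
    obtain ⟨e, he, hm⟩ := exists_norm_eq_smul m
    obtain ⟨s, -, hs⟩ := hball e he.le
    have h1 : A m = (‖m‖ * s) • d := by
      conv_lhs => rw [hm, map_smul, hs, smul_smul]
    rw [hg m _ h1, h1]
  refine ⟨n, le_antisymm ?_ ?_, hA⟩
  · obtain ⟨e, he, hm⟩ := exists_norm_eq_smul n
    obtain ⟨s, hs1, hs⟩ := hball e he.le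
    have h1 := hg e s hs
    rw [hm, inner_smul_left, real_inner_self_eq_norm_sq, he] at h1
    simp at h1
    rw [h1]
    exact (le_abs_self s).trans hs1
  · have hr : r ∈ {x | ∃ m : BlochSpace, ‖m‖ ≤ 1 ∧ x = o + A m} :=
      h ▸ left_mem_segment ℝ r r'
    obtain ⟨m, hm, hr⟩ := hr
    have h1 : A m = (1 : ℝ) • d := by
      rw [← sub_eq_iff_eq_add'] at hr
      rw [← hr, ho, hd]
      module
    have h2 := real_inner_le_norm n m
    rw [hg m 1 h1] at h2
    nlinarith [norm_nonneg n, norm_nonneg m]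

end Ellipsoid


variable {ρ : TwoQubitOp}

/-! ### Perpendicular chords and the normal form -/

section OptimalForm

lemma trace_ofBloch_mul_proj (t : ℝ) (m : BlochSpace) {ψ : Qubit} (hψ : ‖ψ‖ = 1) :
    (ofBloch t m * proj ψ).trace = ((t + inner ℝ (blochVector (proj ψ)) m) / 2 : ℝ) := by
  rw [real_inner_comm, ← star_dotProduct_ofBloch_mulVec t m hψ]
  simp [Matrix.trace_fin_two, Matrix.mul_apply, proj, dotProduct, Matrix.mulVec]
  ring

lemma traceA_kronecker (M N : QubitOp) : traceA (M ⊗ₖ N) = M.trace • N := by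
  ext k l
  simp [traceA, Matrix.trace, add_mul]

/-- The states to which Bob is steered if the state has the optimal form. -/
lemma traceA_ofBloch_optimal {ψ φ χ χ' : Qubit} (hψ : ‖ψ‖ = 1) (hφ : ‖φ‖ = 1) (hχ : ‖χ‖ = 1)
    (hχ' : ‖χ'‖ = 1) (h : inner ℂ ψ φ = 0) (t : ℝ) (m : BlochSpace) :
    traceA ((ofBloch t m ⊗ₖ (1 : QubitOp)) *
        ((1 / 2 : ℂ) • (proj ψ ⊗ₖ proj χ) + (1 / 2 : ℂ) • (proj φ ⊗ₖ proj χ'))) =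
      ofBloch (t / 2) ((1 / 2 : ℝ) • (t • (1 / 2 : ℝ) • (blochVector (proj χ) +
        blochVector (proj χ')) + inner ℝ (blochVector (proj ψ)) m • (1 / 2 : ℝ) •
        (blochVector (proj χ) - blochVector (proj χ')))) := by
  have hadd : ∀ X Y, traceA (X + Y) = traceA X + traceA Y := fun X Y => by
    ext i j; simp [traceA]; ring
  have hsmul : ∀ (a : ℂ) X, traceA (a • X) = a • traceA X := fun a X => by
    ext i j; simp [traceA]; ring
  rw [mul_add, hadd, mul_smul_comm, mul_smul_comm, hsmul, hsmul, ← Matrix.mul_kronecker_mul,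
    ← Matrix.mul_kronecker_mul, traceA_kronecker, traceA_kronecker, trace_ofBloch_mul_proj _ _ hψ,
    trace_ofBloch_mul_proj _ _ hφ, blochVector_proj_orthogonal hψ hφ h, one_mul, one_mul,
    proj_eq_ofBloch hχ, proj_eq_ofBloch hχ', smul_ofBloch, smul_ofBloch, inner_neg_left]
  have hhalf : (1 / 2 : ℂ) = ((1 / 2 : ℝ) : ℂ) := by norm_num
  rw [hhalf, smul_ofBloch, smul_ofBloch, ofBloch_add]
  simp only [blochVector_ofBloch]
  congr 1
  · ring
  · module

/-- Since b and A determine ρ, the normal form can be checked on the centre and the linear part. -/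
lemma IsCanonical.eq_optimal_iff (hρ : IsCanonical ρ) {ψ φ χ χ' : Qubit} (hψ : ‖ψ‖ = 1)
    (hφ : ‖φ‖ = 1) (hχ : ‖χ‖ = 1) (hχ' : ‖χ'‖ = 1) (h : inner ℂ ψ φ = 0) :
    ρ = (1 / 2 : ℂ) • (proj ψ ⊗ₖ proj χ) + (1 / 2 : ℂ) • (proj φ ⊗ₖ proj χ') ↔
      bobVector ρ = (1 / 2 : ℝ) • (blochVector (proj χ) + blochVector (proj χ')) ∧
      ∀ m, steeringMap ρ m = inner ℝ (blochVector (proj ψ)) m •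
        (1 / 2 : ℝ) • (blochVector (proj χ) - blochVector (proj χ')) := by
  constructor
  · intro hform
    have key : ∀ t m, t • bobVector ρ + steeringMap ρ m =
        t • (1 / 2 : ℝ) • (blochVector (proj χ) + blochVector (proj χ')) +
          inner ℝ (blochVector (proj ψ)) m • (1 / 2 : ℝ) •
            (blochVector (proj χ) - blochVector (proj χ')) := fun t m => by
      have h1 := hρ.traceA_ofBloch t m
      conv_lhs at h1 => rw [hform]
      rw [traceA_ofBloch_optimal hψ hφ hχ hχ' h] at h1
      have h2 := congrArg blochVector h1
      simp only [blochVector_ofBloch] at h2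
      exact (smul_right_injective _ (by norm_num : (1 / 2 : ℝ) ≠ 0) h2).symm
    exact ⟨by simpa using key 1 0, fun m => by simpa using key 0 m⟩
  · rintro ⟨hb, hA⟩
    refine ext_of_traceA_ofBloch fun t m => ?_
    rw [hρ.traceA_ofBloch, traceA_ofBloch_optimal hψ hφ hχ hχ' h, hb, hA]

lemma IsCanonical.steeringEllipsoid_eq (hρ : IsCanonical ρ) :
    steeringEllipsoid ρ = {x | ∃ m : BlochSpace, ‖m‖ ≤ 1 ∧ x = bobVector ρ + steeringMap ρ m} :=
  Set.ext fun _ => hρ.mem_steeringEllipsoid_iff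

/-- The unit vector n of the rank-one map A is the Bloch vector of ψ. Perpendicularity is automatic,
as b is the midpoint of two points of equal norm. -/
lemma IsCanonical.isPerpChord_iff_hasOptimalForm (hρ : IsCanonical ρ) {χ χ' : Qubit}
    (hχ : ‖χ‖ = 1) (hχ' : ‖χ'‖ = 1) : IsPerpChord ρ χ χ' ↔ HasOptimalForm ρ χ χ' := by
  constructor
  · rintro ⟨hE, -⟩
    rw [hρ.steeringEllipsoid_eq] at hE
    obtain ⟨n, hn, hA⟩ := exists_map_eq_inner_smul_of_ball_image_eq_segment hE
    obtain ⟨ψ, hψ, rfl⟩ := exists_blochVector_proj_eq hn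
    have hφ : ‖perp ψ‖ = 1 := by rw [norm_perp, hψ]
    exact ⟨ψ, perp ψ, hψ, hφ, inner_perp ψ, (hρ.eq_optimal_iff hψ hφ hχ hχ' (inner_perp ψ)).mpr
      ⟨eq_midpoint_of_ball_image_eq_segment hE, hA⟩⟩
  · rintro ⟨ψ, φ, hψ, hφ, h, hform⟩
    obtain ⟨hb, hA⟩ := (hρ.eq_optimal_iff hψ hφ hχ hχ' h).mp hform
    have hn := norm_blochVector_proj hψ
    constructor
    · rw [hρ.steeringEllipsoid_eq, segment_eq_image']
      ext x
      constructor
      · rintro ⟨m, hm, rfl⟩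
        have h1 := (abs_real_inner_le_norm (blochVector (proj ψ)) m).trans
          (mul_le_one₀ hn.le (norm_nonneg m) hm)
        rw [abs_le] at h1
        refine ⟨(1 - inner ℝ (blochVector (proj ψ)) m) / 2,
          ⟨by linarith [h1.2], by linarith [h1.1]⟩, ?_⟩
        simp only [hA, hb]
        module
      · rintro ⟨s, hs, rfl⟩
        refine ⟨(1 - 2 * s) • blochVector (proj ψ), ?_, ?_⟩
        · rw [norm_smul, hn, mul_one, Real.norm_eq_abs, abs_le]
          exact ⟨by linarith [hs.2], by linarith [hs.1]⟩
        · rw [hA, hb, inner_smul_right, real_inner_self_eq_norm_sq, hn]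
          module
    · rw [hb, inner_smul_left, real_inner_add_sub_eq_zero_iff _ _ |>.mpr, mul_zero]
      rw [norm_blochVector_proj hχ, norm_blochVector_proj hχ']

end OptimalForm

/-! ### The bound on the largest semiaxis and its equality case -/

section Rigidity

/-- A two-by-two matrix whose kernel contains the orthogonal complement of `χ'` and whose range is
spanned by `χ` is a multiple of `|χ⟩⟨χ'|`. -/
lemma eq_smul_of_perp_mulVec_eq_zero {X : QubitOp} {χ χ' : Qubit} (hχ : ‖χ‖ = 1) (hχ' : ‖χ'‖ = 1)
    (h1 : X *ᵥ (perp χ' : Fin 2 → ℂ) = 0) (h2 : star (perp χ : Fin 2 → ℂ) ᵥ* X = 0) :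
    ∃ x : ℂ, ∀ k l, X k l = x * (χ k * star (χ' l)) := by
  have hp : ∀ χ : Qubit, proj χ =
      Matrix.vecMulVec (χ : Fin 2 → ℂ) (star (χ : Fin 2 → ℂ)) := fun _ => rfl
  have h3 : X * proj (perp χ') = 0 := by
    rw [hp, Matrix.mul_vecMulVec, h1, Matrix.zero_vecMulVec]
  have h4 : proj (perp χ) * X = 0 := by
    rw [hp, Matrix.vecMulVec_mul, h2, Matrix.vecMulVec_zero]
  have h5 : X = proj χ * X * proj χ' := by
    rw [eq_sub_of_add_eq (proj_add_proj hχ (by rwa [norm_perp]) (inner_perp χ)),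
      eq_sub_of_add_eq (proj_add_proj hχ' (by rwa [norm_perp]) (inner_perp χ'))]
    rw [sub_mul, h4, sub_zero, one_mul, mul_sub, h3, sub_zero, mul_one]
  refine ⟨∑ i, ∑ j, star (χ i) * X i j * χ' j, fun k l => ?_⟩
  conv_lhs => rw [h5]
  simp [Matrix.mul_apply, proj]
  ring

lemma inner_blochVector_proj {χ χ' : Qubit} (hχ : ‖χ‖ = 1) (hχ' : ‖χ'‖ = 1) :
    inner ℝ (blochVector (proj χ)) (blochVector (proj χ')) = 2 * ‖inner ℂ χ χ'‖ ^ 2 - 1 := by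
  have h := trace_ofBloch_mul_proj 1 (blochVector (proj χ')) hχ
  rw [← proj_eq_ofBloch hχ'] at h
  have h2 : (proj χ' * proj χ).trace = (‖inner ℂ χ χ'‖ ^ 2 : ℝ) := by
    rw [← Complex.normSq_eq_norm_sq, ← Complex.mul_conj, inner_qubit]
    simp [Matrix.trace_fin_two, Matrix.mul_apply, proj]
    ring
  rw [h2] at h
  have h3 : ‖inner ℂ χ χ'‖ ^ 2 = (1 + inner ℝ (blochVector (proj χ)) (blochVector (proj χ'))) / 2 :=
    by exact_mod_cast h
  linarith

/-- Bob's operator `⟨ψ|ρ|φ⟩`. -/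
noncomputable def partialInner (ρ : TwoQubitOp) (ψ φ : Qubit) : QubitOp :=
  traceA ((Matrix.vecMulVec (φ : Fin 2 → ℂ) (star (ψ : Fin 2 → ℂ)) ⊗ₖ (1 : QubitOp)) * ρ)

lemma partialInner_apply (ρ : TwoQubitOp) (ψ φ : Qubit) (k l : Fin 2) :
    partialInner ρ ψ φ k l = ∑ i, ∑ j, φ i * star (ψ j) * ρ (j, k) (i, l) := by
  simp [partialInner, traceA_kronecker_mul_apply, Matrix.vecMulVec_apply]

lemma conjTranspose_partialInner (hρ : ρ.IsHermitian) (ψ φ : Qubit) :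
    (partialInner ρ ψ φ)ᴴ = partialInner ρ φ ψ := by
  rw [partialInner, traceA_kronecker_mul_conjTranspose hρ, Matrix.conjTranspose_vecMulVec,
    star_star, partialInner]

lemma partialInner_self (ρ : TwoQubitOp) (ψ : Qubit) :
    partialInner ρ ψ ψ = traceA ((proj ψ ⊗ₖ (1 : QubitOp)) * ρ) := rfl

/-- For ρ ≥ 0 a vanishing expectation in φ ⊗ η means ρ(φ ⊗ η) = 0, which kills every block ⟨ψ|ρ|φ⟩
on η. -/
lemma partialInner_mulVec_eq_zero (hρ : ρ.PosSemidef) (ψ φ η : Qubit)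
    (h : star (η : Fin 2 → ℂ) ⬝ᵥ (partialInner ρ φ φ *ᵥ (η : Fin 2 → ℂ)) = 0) :
    partialInner ρ ψ φ *ᵥ (η : Fin 2 → ℂ) = 0 := by
  rw [partialInner_self, expectation_kronecker, hρ.dotProduct_mulVec_zero_iff] at h
  ext k
  have h0 := congrFun h (0, k)
  have h1 := congrFun h (1, k)
  simp [Matrix.mulVec, dotProduct, Fintype.sum_prod_type] at h0 h1
  simp [Matrix.mulVec, dotProduct, partialInner_apply]
  linear_combination starRingEnd ℂ (ψ 0) * h0 + starRingEnd ℂ (ψ 1) * h1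

/-- A state is the sum of its blocks with respect to an orthonormal basis of Alice's qubit. -/
lemma eq_sum_kronecker_partialInner (ρ : TwoQubitOp) {ψ φ : Qubit} (h : proj ψ + proj φ = 1) :
    ρ = proj ψ ⊗ₖ partialInner ρ ψ ψ + proj φ ⊗ₖ partialInner ρ φ φ +
      Matrix.vecMulVec (ψ : Fin 2 → ℂ) (star (φ : Fin 2 → ℂ)) ⊗ₖ partialInner ρ ψ φ +
      Matrix.vecMulVec (φ : Fin 2 → ℂ) (star (ψ : Fin 2 → ℂ)) ⊗ₖ partialInner ρ φ ψ := by
  have hc : ∀ i j, ψ i * star (ψ j) + φ i * star (φ j) = if i = j then 1 else 0 := fun i j => by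
    simpa [proj, Matrix.one_apply] using congrFun₂ h i j
  ext ⟨i, k⟩ ⟨j, l⟩
  have h1 : ρ (i, k) (j, l) = ∑ i', ∑ j', (ψ i * star (ψ i') + φ i * star (φ i')) *
      (ψ j' * star (ψ j) + φ j' * star (φ j)) * ρ (i', k) (j', l) := by
    simp only [hc]
    simp
  rw [h1]
  simp [partialInner_apply, proj, Matrix.vecMulVec_apply]
  ring

/-- If Alice can steer Bob to a pair of pure states with opposite projective outcomes, and Bob's
reduced state is non-degenerate, then the state has the optimal form. -/
lemma IsCanonical.eq_optimal_of_pure (hρ : IsCanonical ρ) (hb : bobVector ρ ≠ 0)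
    {ψ χ χ' : Qubit} (hψ : ‖ψ‖ = 1) (hχ : ‖χ‖ = 1) (hχ' : ‖χ'‖ = 1)
    (h : blochVector (proj χ) = bobVector ρ + steeringMap ρ (blochVector (proj ψ)))
    (h' : blochVector (proj χ') = bobVector ρ - steeringMap ρ (blochVector (proj ψ))) :
    HasOptimalForm ρ χ χ' := by
  have hφ : ‖perp ψ‖ = 1 := by rw [norm_perp, hψ]
  have hψφ := inner_perp ψ
  have hφn := blochVector_proj_perp ψ
  set φ := perp ψ
  have hhalf : (1 / 2 : ℂ) = ((1 / 2 : ℝ) : ℂ) := by norm_num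
  have e1 : partialInner ρ ψ ψ = (1 / 2 : ℂ) • proj χ := by
    rw [partialInner_self, proj_eq_ofBloch hψ, hρ.traceA_ofBloch, one_smul, ← h,
      proj_eq_ofBloch hχ, hhalf, smul_ofBloch, mul_one, blochVector_ofBloch]
  have e2 : partialInner ρ φ φ = (1 / 2 : ℂ) • proj χ' := by
    rw [partialInner_self, proj_eq_ofBloch hφ, hρ.traceA_ofBloch, one_smul, hφn, map_neg,
      ← sub_eq_add_neg, ← h', proj_eq_ofBloch hχ', hhalf, smul_ofBloch, mul_one,
      blochVector_ofBloch]
  have hperp : ∀ χ : Qubit,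
      star (perp χ : Fin 2 → ℂ) ⬝ᵥ (((1 / 2 : ℂ) • proj χ) *ᵥ (perp χ : Fin 2 → ℂ)) = 0 := by
    intro χ
    simp [dotProduct, Matrix.mulVec, proj, perp]
    ring
  have k1 := partialInner_mulVec_eq_zero hρ.posSemidef ψ φ (perp χ') (by rw [e2, hperp])
  have k2 := partialInner_mulVec_eq_zero hρ.posSemidef φ ψ (perp χ) (by rw [e1, hperp])
  have k3 : star (perp χ : Fin 2 → ℂ) ᵥ* partialInner ρ ψ φ = 0 := by
    rw [← conjTranspose_partialInner hρ.posSemidef.isHermitian φ ψ, ← Matrix.star_mulVec, k2,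
      star_zero]
  obtain ⟨x, hx⟩ := eq_smul_of_perp_mulVec_eq_zero hχ hχ' k1 k3
  -- This trace is a matrix element of Alice's marginal ½·1 between orthogonal vectors.
  have htr : (partialInner ρ ψ φ).trace = 0 := by
    rw [partialInner, trace_traceA, hρ.trace_kronecker_mul]
    rw [inner_qubit] at hψφ
    simp only [Matrix.trace_fin_two, Matrix.vecMulVec_apply, Pi.star_apply]
    linear_combination hψφ / 2
  have hx0 : x = 0 := by
    have h1 : x * inner ℂ χ' χ = 0 := by
      rw [← htr, inner_qubit, Matrix.trace_fin_two, hx, hx]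
      ring
    -- Orthogonal χ, χ' have antipodal Bloch vectors, whose midpoint is b.
    refine (mul_eq_zero.mp h1).resolve_right fun h2 => hb ?_
    have h3 := inner_blochVector_proj hχ' hχ
    have h4 := norm_add_sq_real (blochVector (proj χ')) (blochVector (proj χ))
    rw [h3, h2, norm_blochVector_proj hχ, norm_blochVector_proj hχ'] at h4
    norm_num at h4
    have h5 : bobVector ρ = (1 / 2 : ℝ) • (blochVector (proj χ') + blochVector (proj χ)) := by
      rw [h, h']; module
    rw [h5, h4, smul_zero]
  have e3 : partialInner ρ ψ φ = 0 := by
    ext k l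
    rw [hx, hx0, zero_mul, Matrix.zero_apply]
  have e4 : partialInner ρ φ ψ = 0 := by
    rw [← conjTranspose_partialInner hρ.posSemidef.isHermitian, e3, Matrix.conjTranspose_zero]
  refine ⟨ψ, φ, hψ, hφ, hψφ, ?_⟩
  have hdec := eq_sum_kronecker_partialInner ρ (proj_add_proj hψ hφ hψφ)
  rw [e1, e2, e3, e4, Matrix.kronecker_zero, Matrix.kronecker_zero, add_zero, add_zero,
    Matrix.kronecker_smul, Matrix.kronecker_smul] at hdec
  exact hdec

/-- The parallelogram law for b ± A e, both of norm at most 1, where e is the direction of m. -/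
lemma IsCanonical.norm_bobVector_sq_add_le (hρ : IsCanonical ρ) {m : BlochSpace} (hm : ‖m‖ ≤ 1) :
    ‖bobVector ρ‖ ^ 2 + ‖steeringMap ρ m‖ ^ 2 ≤ 1 := by
  obtain ⟨e, he, hme⟩ := exists_norm_eq_smul m
  have h1 := hρ.norm_add_steeringMap_le_one he
  have h2 := hρ.norm_add_steeringMap_le_one (m := -e) (by rwa [norm_neg])
  rw [map_neg, ← sub_eq_add_neg] at h2
  have h3 := parallelogram_law_with_norm ℝ (bobVector ρ) (steeringMap ρ e)
  have h4 : ‖steeringMap ρ m‖ ≤ ‖steeringMap ρ e‖ := by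
    rw [hme, map_smul, norm_smul, norm_norm]
    exact mul_le_of_le_one_left (norm_nonneg _) hm
  nlinarith [norm_nonneg (bobVector ρ + steeringMap ρ e), norm_nonneg (steeringMap ρ m),
    norm_nonneg (bobVector ρ - steeringMap ρ e)]

/-- Equality in the parallelogram estimate puts both b ± A e on the Bloch sphere, so opposite
outcomes steer Bob to pure states. -/
lemma IsCanonical.exists_isPerpChord (hρ : IsCanonical ρ) (hb : bobVector ρ ≠ 0) {m : BlochSpace}
    (hm : ‖m‖ ≤ 1) (h : ‖bobVector ρ‖ ^ 2 + ‖steeringMap ρ m‖ ^ 2 = 1) :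
    ∃ χ χ' : Qubit, ‖χ‖ = 1 ∧ ‖χ'‖ = 1 ∧ IsPerpChord ρ χ χ' := by
  obtain ⟨e, he, hme⟩ := exists_norm_eq_smul m
  have h1 := hρ.norm_add_steeringMap_le_one he
  have h2 := hρ.norm_add_steeringMap_le_one (m := -e) (by rwa [norm_neg])
  rw [map_neg, ← sub_eq_add_neg] at h2
  have h3 := parallelogram_law_with_norm ℝ (bobVector ρ) (steeringMap ρ e)
  have h4 : ‖steeringMap ρ m‖ ≤ ‖steeringMap ρ e‖ := by
    rw [hme, map_smul, norm_smul, norm_norm]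
    exact mul_le_of_le_one_left (norm_nonneg _) hm
  have h5 : ‖bobVector ρ + steeringMap ρ e‖ = 1 := by
    nlinarith [norm_nonneg (bobVector ρ + steeringMap ρ e), norm_nonneg (steeringMap ρ m),
      norm_nonneg (bobVector ρ - steeringMap ρ e)]
  have h6 : ‖bobVector ρ - steeringMap ρ e‖ = 1 := by
    nlinarith [norm_nonneg (bobVector ρ + steeringMap ρ e), norm_nonneg (steeringMap ρ m),
      norm_nonneg (bobVector ρ - steeringMap ρ e)]
  obtain ⟨ψ, hψ, rfl⟩ := exists_blochVector_proj_eq he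
  obtain ⟨χ, hχ, hχe⟩ := exists_blochVector_proj_eq h5
  obtain ⟨χ', hχ', hχe'⟩ := exists_blochVector_proj_eq h6
  exact ⟨χ, χ', hχ, hχ', (hρ.isPerpChord_iff_hasOptimalForm hχ hχ').mpr
    (hρ.eq_optimal_of_pure hb hψ hχ hχ' hχe hχe')⟩

end Rigidity

/-! ### Maximal steered coherence -/

section Coherence

lemma coherence_nonneg (σ : QubitOp) (ξ : OrthonormalBasis (Fin 2) ℂ Qubit) :
    0 ≤ coherence σ ξ :=
  Finset.sum_nonneg fun i _ => Finset.sum_nonneg fun j _ => by split_ifs <;> positivity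

lemma exists_isEigenbasis {σ : QubitOp} (hσ : σ.IsHermitian) : ∃ ξ, IsEigenbasis σ ξ :=
  ⟨hσ.eigenvectorBasis, fun i => ⟨hσ.eigenvalues i, by
    rw [Matrix.toLpLin_apply, hσ.mulVec_eigenvectorBasis]
    ext j
    simp⟩⟩

lemma IsEigenbasis.coherence_eq_zero {σ : QubitOp} {ξ : OrthonormalBasis (Fin 2) ℂ Qubit}
    (h : IsEigenbasis σ ξ) : coherence σ ξ = 0 := by
  refine Finset.sum_eq_zero fun i _ => Finset.sum_eq_zero fun j _ => ?_
  split_ifs with hij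
  · rfl
  · obtain ⟨μ, hμ⟩ := h j
    rw [hμ, inner_smul_right, ξ.orthonormal.2 hij, mul_zero, norm_zero]

/-- The eigenbases of a qubit state lie along its Bloch vector. -/
lemma IsEigenbasis.eq_inner_smul {t : ℝ} {v : BlochSpace} {ξ : OrthonormalBasis (Fin 2) ℂ Qubit}
    (h : IsEigenbasis (ofBloch t v) ξ) :
    v = inner ℝ v (blochVector (proj (ξ 0))) • blochVector (proj (ξ 0)) := by
  have h1 := h.coherence_eq_zero
  rw [coherence_ofBloch, Real.sqrt_eq_zero'] at h1
  have hn := norm_blochVector_proj (ξ.orthonormal.1 0)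
  set n := blochVector (proj (ξ 0))
  have h2 := norm_sub_sq_real v (inner ℝ v n • n)
  rw [inner_smul_right, norm_smul, hn, mul_one, Real.norm_eq_abs, sq_abs] at h2
  rw [← sub_eq_zero, ← norm_eq_zero, ← sq_eq_zero_iff]
  nlinarith [sq_nonneg ‖v - inner ℝ v n • n‖]

/-- The coherence, in the eigenbasis of a qubit state, of a state with a shifted Bloch vector. -/
lemma IsEigenbasis.coherence_add {t : ℝ} {v : BlochSpace} {ξ : OrthonormalBasis (Fin 2) ℂ Qubit}
    (h : IsEigenbasis (ofBloch t v) ξ) (s : ℝ) (w : BlochSpace) :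
    coherence (ofBloch s (v + w)) ξ = √(‖w‖ ^ 2 - inner ℝ w (blochVector (proj (ξ 0))) ^ 2) := by
  have h1 := h.eq_inner_smul
  have hn := norm_blochVector_proj (ξ.orthonormal.1 0)
  rw [coherence_ofBloch]
  set n := blochVector (proj (ξ 0))
  set β := inner ℝ v n
  rw [norm_add_sq_real, inner_add_left, h1, norm_smul, inner_smul_left, inner_smul_left,
    real_inner_comm, real_inner_self_eq_norm_sq, hn, Real.norm_eq_abs, mul_one, sq_abs]
  congr 1
  simp
  ring

lemma IsCanonical.isGreatest_maxCoherenceIn (hρ : IsCanonical ρ)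
    (ξ : OrthonormalBasis (Fin 2) ℂ Qubit) :
    IsGreatest (steeredCoherences ρ ξ) (maxCoherenceIn ρ ξ) := by
  have hc : Continuous fun m => coherence (ofBloch 1 (bobVector ρ + steeringMap ρ m)) ξ := by
    simp only [coherence_ofBloch]
    have := (steeringMap ρ).continuous_of_finiteDimensional
    fun_prop
  have hK : IsCompact (steeredCoherences ρ ξ) := by
    rw [hρ.steeredCoherences_eq]
    exact (isCompact_closedBall _ _).image hc
  have hne : (steeredCoherences ρ ξ).Nonempty := by
    rw [hρ.steeredCoherences_eq]
    exact (Metric.nonempty_closedBall.mpr zero_le_one).image _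
  exact hK.isGreatest_sSup hne

lemma IsCanonical.coherence_le_maxCoherenceIn (hρ : IsCanonical ρ)
    (ξ : OrthonormalBasis (Fin 2) ℂ Qubit) {m : BlochSpace} (hm : ‖m‖ ≤ 1) :
    coherence (ofBloch 1 (bobVector ρ + steeringMap ρ m)) ξ ≤ maxCoherenceIn ρ ξ := by
  refine (hρ.isGreatest_maxCoherenceIn ξ).2 ?_
  rw [hρ.steeredCoherences_eq]
  exact ⟨m, by simpa using hm, rfl⟩

/-- Any one eigenbasis will do: its axis passes through b, so the distance of b + A m from it is at
most |A m|. -/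
lemma IsCanonical.maximalSteeredCoherence_le (hρ : IsCanonical ρ) {c : ℝ}
    (hc : ∀ m : BlochSpace, ‖m‖ ≤ 1 → ‖steeringMap ρ m‖ ≤ c) : maximalSteeredCoherence ρ ≤ c := by
  obtain ⟨ξ, hξ⟩ := exists_isEigenbasis (isHermitian_ofBloch 1 (bobVector ρ))
  rw [← hρ.traceA_eq] at hξ
  have hbdd : BddBelow (Set.range fun ξ : {ξ // IsEigenbasis (traceA ρ) ξ} =>
      maxCoherenceIn ρ ξ.1) := by
    refine ⟨0, ?_⟩
    rintro _ ⟨η, rfl⟩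
    exact (coherence_nonneg _ _).trans (hρ.coherence_le_maxCoherenceIn η.1 (m := 0) (by simp))
  refine (ciInf_le hbdd ⟨ξ, hξ⟩).trans ?_
  have h1 := (hρ.isGreatest_maxCoherenceIn ξ).1
  rw [hρ.steeredCoherences_eq] at h1
  obtain ⟨m, hm, h1⟩ := h1
  rw [hρ.traceA_eq] at hξ
  have hm' : ‖m‖ ≤ 1 := by simpa using hm
  simp only [hξ.coherence_add] at h1
  rw [← h1]
  refine Real.sqrt_le_iff.mpr ⟨(norm_nonneg _).trans (hc m hm'), ?_⟩
  have := hc m hm'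
  nlinarith [norm_nonneg (steeringMap ρ m),
    sq_nonneg (inner ℝ (steeringMap ρ m) (blochVector (proj (ξ 0))))]

/-- At the end χ of the chord A m is orthogonal to b, so Pythagoras gives its length and all of it
counts as coherence. -/
lemma IsCanonical.le_maximalSteeredCoherence_of_isPerpChord (hρ : IsCanonical ρ)
    (hb : bobVector ρ ≠ 0) {χ χ' : Qubit} (hχ : ‖χ‖ = 1)
    (h : IsPerpChord ρ χ χ') : √(1 - ‖bobVector ρ‖ ^ 2) ≤ maximalSteeredCoherence ρ := by
  obtain ⟨hE, hperp⟩ := h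
  rw [hρ.steeringEllipsoid_eq] at hE
  have hmid := eq_midpoint_of_ball_image_eq_segment hE
  obtain ⟨m, hm, hr⟩ : blochVector (proj χ) ∈
      {x | ∃ m : BlochSpace, ‖m‖ ≤ 1 ∧ x = bobVector ρ + steeringMap ρ m} :=
    hE ▸ left_mem_segment ℝ _ _
  have hA : steeringMap ρ m = (1 / 2 : ℝ) • (blochVector (proj χ) - blochVector (proj χ')) := by
    rw [← sub_eq_iff_eq_add'] at hr
    rw [← hr, hmid]
    module
  have horth : inner ℝ (bobVector ρ) (steeringMap ρ m) = 0 := by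
    rw [hA, inner_smul_right, hperp, mul_zero]
  have hnorm : 1 - ‖bobVector ρ‖ ^ 2 = ‖steeringMap ρ m‖ ^ 2 := by
    have h1 := norm_add_sq_real (bobVector ρ) (steeringMap ρ m)
    rw [← hr, norm_blochVector_proj hχ, horth] at h1
    linarith
  obtain ⟨ξ₀, hξ₀⟩ := exists_isEigenbasis (isHermitian_ofBloch 1 (bobVector ρ))
  rw [← hρ.traceA_eq] at hξ₀
  have : Nonempty {ξ // IsEigenbasis (traceA ρ) ξ} := ⟨⟨ξ₀, hξ₀⟩⟩
  refine le_ciInf fun ⟨ξ, hξ⟩ => ?_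
  rw [hρ.traceA_eq] at hξ
  refine le_trans ?_ (hρ.coherence_le_maxCoherenceIn ξ hm)
  rw [hξ.coherence_add, hnorm]
  have h1 := hξ.eq_inner_smul
  set n := blochVector (proj (ξ 0))
  -- As b ≠ 0 is a multiple of n, orthogonality to b passes to n.
  have h2 : inner ℝ (steeringMap ρ m) n = 0 := by
    rw [h1, inner_smul_left] at horth
    rw [real_inner_comm]
    refine (mul_eq_zero.mp horth).resolve_left fun h3 => hb ?_
    rw [h1]
    simp at h3
    rw [h3, zero_smul]
  rw [h2]
  simp

end Coherence

end SteeredCoherence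

/-! ### The main theorem -/

theorem theorem2 (ρ : SteeredCoherence.TwoQubitOp) (hρ : SteeredCoherence.IsCanonical ρ) :
    -- the maxima in the definition of the maximal steered coherence exist
    (∀ ξ, SteeredCoherence.IsEigenbasis (SteeredCoherence.traceA ρ) ξ →
      IsGreatest (SteeredCoherence.steeredCoherences ρ ξ)
        (SteeredCoherence.maxCoherenceIn ρ ξ)) ∧
    -- Bob's steering ellipsoid is indeed an ellipsoid
    (∃ c, SteeredCoherence.HasSemiaxes (SteeredCoherence.steeringEllipsoid ρ) c) ∧
    -- the bounds, and the case of equality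
    (∀ c, SteeredCoherence.HasSemiaxes (SteeredCoherence.steeringEllipsoid ρ) c →
      SteeredCoherence.maximalSteeredCoherence ρ ≤ c 0 ∧
      c 0 ≤ √(1 - ‖SteeredCoherence.bobVector ρ‖ ^ 2) ∧
      (SteeredCoherence.bobVector ρ ≠ 0 →
        (c 0 = √(1 - ‖SteeredCoherence.bobVector ρ‖ ^ 2) ↔
          ∃ χ χ' : SteeredCoherence.Qubit, ‖χ‖ = 1 ∧ ‖χ'‖ = 1 ∧
            SteeredCoherence.IsPerpChord ρ χ χ'))) ∧
    (SteeredCoherence.bobVector ρ ≠ 0 →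
      (SteeredCoherence.maximalSteeredCoherence ρ =
          √(1 - ‖SteeredCoherence.bobVector ρ‖ ^ 2) ↔
        ∃ χ χ' : SteeredCoherence.Qubit, ‖χ‖ = 1 ∧ ‖χ'‖ = 1 ∧
          SteeredCoherence.IsPerpChord ρ χ χ')) ∧
    -- the states whose steering ellipsoid is a chord perpendicular to Bob's Bloch vector
    (∀ χ χ' : SteeredCoherence.Qubit, ‖χ‖ = 1 → ‖χ'‖ = 1 →
      (SteeredCoherence.IsPerpChord ρ χ χ' ↔ SteeredCoherence.HasOptimalForm ρ χ χ')) := by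
  have hex : ∃ c, SteeredCoherence.HasSemiaxes (SteeredCoherence.steeringEllipsoid ρ) c := by
    rw [hρ.steeringEllipsoid_eq]
    exact SteeredCoherence.exists_hasSemiaxes _ _
  have hbound : ∀ c, SteeredCoherence.HasSemiaxes (SteeredCoherence.steeringEllipsoid ρ) c →
      SteeredCoherence.maximalSteeredCoherence ρ ≤ c 0 ∧
      c 0 ≤ √(1 - ‖SteeredCoherence.bobVector ρ‖ ^ 2) := by
    intro c hc
    rw [hρ.steeringEllipsoid_eq] at hc
    refine ⟨hρ.maximalSteeredCoherence_le fun m hm => hc.norm_map_le hm, ?_⟩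
    obtain ⟨m, hm, hmc⟩ := hc.exists_norm_map_eq
    rw [← hmc]
    exact Real.le_sqrt_of_sq_le (by linarith [hρ.norm_bobVector_sq_add_le hm])
  have hchord : SteeredCoherence.bobVector ρ ≠ 0 →
      ∀ c, SteeredCoherence.HasSemiaxes (SteeredCoherence.steeringEllipsoid ρ) c →
      c 0 = √(1 - ‖SteeredCoherence.bobVector ρ‖ ^ 2) →
      ∃ χ χ' : SteeredCoherence.Qubit, ‖χ‖ = 1 ∧ ‖χ'‖ = 1 ∧
        SteeredCoherence.IsPerpChord ρ χ χ' := by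
    intro hb c hc h
    rw [hρ.steeringEllipsoid_eq] at hc
    obtain ⟨m, hm, hmc⟩ := hc.exists_norm_map_eq
    refine hρ.exists_isPerpChord hb hm ?_
    have h0 := hρ.norm_bobVector_sq_add_le hm
    rw [hmc, h, Real.sq_sqrt (by nlinarith [sq_nonneg ‖SteeredCoherence.steeringMap ρ m‖])]
    ring
  refine ⟨fun ξ _ => hρ.isGreatest_maxCoherenceIn ξ, hex, fun c hc => ?_,
    fun hb => ⟨fun h => ?_, ?_⟩, fun χ χ' hχ hχ' => hρ.isPerpChord_iff_hasOptimalForm hχ hχ'⟩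
  · obtain ⟨h1, h2⟩ := hbound c hc
    refine ⟨h1, h2, fun hb => ⟨hchord hb c hc, ?_⟩⟩
    rintro ⟨χ, χ', hχ, hχ', h⟩
    -- For a chord, √(1 - b²) ≤ C ≤ c₁ ≤ √(1 - b²).
    exact h2.antisymm ((hρ.le_maximalSteeredCoherence_of_isPerpChord hb hχ h).trans h1)
  · obtain ⟨c, hc⟩ := hex
    obtain ⟨h1, h2⟩ := hbound c hc
    exact hchord hb c hc (h2.antisymm (h ▸ h1))
  · rintro ⟨χ, χ', hχ, hχ', h⟩
    obtain ⟨c, hc⟩ := hex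
    obtain ⟨h1, h2⟩ := hbound c hc
    exact (h1.trans h2).antisymm (hρ.le_maximalSteeredCoherence_of_isPerpChord hb hχ h)
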